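/- Notation. For positive integers $n, a_1,\dots,a_n$ and an integer $N \le \sum_{i=1}^n a_i$, put $\mathfrak m(a_1,\dots,a_n;N) = 1$ if $N < n$ (in particular if $N\le 0$), and otherwise let $\mathfrak m(a_1,\dots,a_n;N)$ be the minimum of $\prod_{i=1}^n y_i$ over all $(y_1,\dots,y_n)\in\mathbb Z^n$ with $1\le y_i\le a_i$ for all $i$ and $\sum_{i=1}^n y_i = N$. For a ring $R$, a subset $B\subset R$, an ideal $I$ and $x\in R$, write $x\in B \pmod I$ if there is $b\in B$ with $x-b\in I$. The degree $\deg f$ of a polynomial is its total degree, with $\deg 0 = 0$. Theorem. Let $R$ be a Dedekind domain and $\mathfrak p$ a maximal ideal of $R$ with finite residue field $R/\mathfrak p\cong\mathbb F_q$. Let $n, r, v_1,\dots,v_r$ be positive integers. Let $A_1,\dots,A_n,B_1,\dots,B_r\subset R$ be nonempty subsets, each having the property that no two distinct elements of it are congruent modulo $\mathfrak p$ (so each of these sets is finite). Let $f_1,\dots,f_r\in R[t_1,\dots,t_n]$, and put $$Z=\Bigl\{x\in\prod_{i=1}^n A_i \;\Bigm|\; f_j(x)\in B_j \pmod{\mathfrak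 p^{v_j}}\ \text{for all } 1\le j\le r\Bigr\}.$$ Then either $Z=\varnothing$ or $$\# Z\ \ge\ \mathfrak m\Bigl(\#A_1,\dots,\#A_n;\ \sum_{i=1}^n \#A_i-\sum_{j=1}^r\bigl(q^{v_j}-\#B_j\bigr)\deg f_j\Bigr).$$ -/

import Mathlib

/-- `x ∈ B (mod I)`: there is `b ∈ B` with `x - b ∈ I`. -/
def MemMod {R : Type*} [CommRing R] (B : Set R) (I : Ideal R) (x : R) : Prop :=
  ∃ b ∈ B, x - b ∈ I

/-- No two distinct elements of `A` are congruent modulo `I`. -/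
def PairwiseIncongruent {R : Type*} [CommRing R] (A : Set R) (I : Ideal R) : Prop :=
  ∀ x ∈ A, ∀ y ∈ A, x ≠ y → x - y ∉ I

/-- The number `𝔪(a₁, …, aₙ; N)`: it is `1` if `N < n`, and otherwise it is the minimum of
`∏ yᵢ` over all integer tuples with `1 ≤ yᵢ ≤ aᵢ` and `∑ yᵢ = N`. Such tuples exist if all
`aᵢ ≥ 1` and `n ≤ N ≤ ∑ aᵢ`; for `N > ∑ aᵢ` the number is not meaningful. The integer `N` may be
negative. -/
noncomputable def minProd {n : ℕ} (a : Fin n → ℕ) (N : ℤ) : ℕ :=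
  if N < (n : ℤ) then 1
  else sInf {P : ℕ | ∃ y : Fin n → ℕ,
    (∀ i, 1 ≤ y i ∧ y i ≤ a i) ∧ (∑ i, (y i : ℤ)) = N ∧ P = ∏ i, y i}

/-- The set of `x ∈ ∏ Aᵢ` with `f_j(x) ∈ B_j (mod 𝔭^{v_j})` for all `j`. -/
def solutionSet {R : Type*} [CommRing R] {n r : ℕ} (p : Ideal R) (v : Fin r → ℕ)
    (A : Fin n → Set R) (B : Fin r → Set R) (f : Fin r → MvPolynomial (Fin n) R) :
    Set (Fin n → R) :=
  {x | (∀ i, x i ∈ A i) ∧ ∀ j, MemMod (B j) (p ^ v j) (MvPolynomial.eval x (f j))}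

/-! For each j some g_j ∈ R[X] of degree at most q^{v_j} - #B_j has all its values in 𝔭^{c_j}, and
g_j(x) lies outside 𝔭^{c_j+1} exactly when x ∈ B_j (mod 𝔭^{v_j}): take the product of X - a over
representatives a of the classes modulo 𝔭^{v_j} that miss B_j
(`exists_polynomial_notMem_pow_iff_memMod`). Since 𝔭-adic orders add, P = ∏ g_j(f_j) is nonzero
modulo 𝔭^N, N = ∑ c_j + 1, at exactly those grid points that lie in Z.

Distinct elements of A_i differ by units modulo 𝔭^N, so the Alon–Füredi bound holds over R/𝔭^N
despite its zero divisors (`MvPolynomial.minProd_le_card_eval_ne_zero`). Applied to P it bounds #Z.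
-/

/-! ### The minimal product 𝔪(a; N) -/

theorem exists_le_sum_eq_of_one_le {n N : ℕ} (hN : n ≤ N) (k : ℕ) :
    ∀ y : Fin n → ℕ, (∀ i, 1 ≤ y i) → ∑ i, y i = N + k →
      ∃ z : Fin n → ℕ, (∀ i, 1 ≤ z i ∧ z i ≤ y i) ∧ ∑ i, z i = N := by
  induction k with
  | zero => exact fun y hy h => ⟨y, fun i => ⟨hy i, le_rfl⟩, h⟩
  | succ k ih =>
    intro y hy h
    obtain ⟨i, hi⟩ : ∃ i, 2 ≤ y i := by
      by_contra! hlt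
      have : ∑ i, y i ≤ ∑ _i : Fin n, 1 := Finset.sum_le_sum fun i _ => by have := hlt i; omega
      simp at this
      omega
    have hsum := Finset.add_sum_erase Finset.univ y (Finset.mem_univ i)
    obtain ⟨z, hz, hzN⟩ := ih (Function.update y i (y i - 1))
      (fun j => by
        by_cases hj : j = i
        · subst hj; simp; omega
        · simp [hj, hy j])
      (by
        rw [Finset.sum_update_of_mem (Finset.mem_univ i), ← Finset.erase_eq]
        omega)
    refine ⟨z, fun j => ⟨(hz j).1, (hz j).2.trans ?_⟩, hzN⟩
    by_cases hj : j = i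
    · subst hj; simp
    · simp [hj]

/-- Lowering entries one at a time brings the sum down to N without raising the product. With
`exists_minProd_eq_prod` this gives monotonicity in N, so upper bounds on degrees suffice later. -/
theorem minProd_le_prod {n : ℕ} {a y : Fin n → ℕ} {N : ℤ} (hy : ∀ i, 1 ≤ y i)
    (hya : ∀ i, y i ≤ a i) (hN : N ≤ ∑ i, (y i : ℤ)) : minProd a N ≤ ∏ i, y i := by
  unfold minProd
  split_ifs with h
  · exact Finset.one_le_prod' fun i _ => hy i
  · lift N to ℕ using by omega
    have hN' : N ≤ ∑ i, y i := by exact_mod_cast hN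
    obtain ⟨z, hz, hzN⟩ := exists_le_sum_eq_of_one_le (n := n) (N := N) (by omega)
      (∑ i, y i - N) y hy (by omega)
    refine (Nat.sInf_le ?_).trans (Finset.prod_le_prod' fun i _ => (hz i).2)
    exact ⟨z, fun i => ⟨(hz i).1, (hz i).2.trans (hya i)⟩, by exact_mod_cast hzN, rfl⟩

theorem exists_minProd_eq_prod {n : ℕ} {a : Fin n → ℕ} {N : ℤ} (ha : ∀ i, 1 ≤ a i)
    (hN : N ≤ ∑ i, (a i : ℤ)) :
    ∃ y : Fin n → ℕ, (∀ i, 1 ≤ y i ∧ y i ≤ a i) ∧ N ≤ ∑ i, (y i : ℤ) ∧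
      minProd a N = ∏ i, y i := by
  unfold minProd
  split_ifs with h
  · exact ⟨fun _ => 1, fun i => ⟨le_rfl, ha i⟩, by simpa using h.le, by simp⟩
  · lift N to ℕ using by omega
    have hN' : N ≤ ∑ i, a i := by exact_mod_cast hN
    obtain ⟨z, hz, hzN⟩ := exists_le_sum_eq_of_one_le (n := n) (N := N) (by omega)
      (∑ i, a i - N) a ha (by omega)
    obtain ⟨y, hy, hyN, hP⟩ := Nat.sInf_mem (s := {P : ℕ | ∃ y : Fin n → ℕ,
      (∀ i, 1 ≤ y i ∧ y i ≤ a i) ∧ (∑ i, (y i : ℤ)) = N ∧ P = ∏ i, y i})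
      ⟨_, z, hz, by exact_mod_cast hzN, rfl⟩
    exact ⟨y, hy, hyN.ge, hP⟩

/-! ### The Alon–Füredi theorem over a commutative ring -/

section AlonFuredi

variable {S : Type*} [CommRing S]

/-- After X - a is factored out, the unit b - a cancels at every other root b, so zero divisors do
no harm. -/
theorem Polynomial.card_le_natDegree_of_isUnit_sub (s : Finset S) :
    ∀ f : Polynomial S, f ≠ 0 → (∀ a ∈ s, ∀ b ∈ s, a ≠ b → IsUnit (a - b)) →
      (∀ a ∈ s, f.eval a = 0) → s.card ≤ f.natDegree := by
  classical
  induction s using Finset.induction_on with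
  | empty => simp
  | insert a s ha ih =>
    intro f hf hs hroot
    have : Nontrivial S := by
      by_contra hS
      rw [not_nontrivial_iff_subsingleton] at hS
      exact hf (Subsingleton.elim _ _)
    obtain ⟨g, rfl⟩ := Polynomial.dvd_iff_isRoot.mpr (hroot a (Finset.mem_insert_self a s))
    have hg : g ≠ 0 := by rintro rfl; simp at hf
    rw [Finset.card_insert_of_notMem ha, (Polynomial.monic_X_sub_C a).natDegree_mul' hg,
      Polynomial.natDegree_X_sub_C, add_comm]
    refine Nat.add_le_add_left (ih g hg (fun b hb c hc => hs b (Finset.mem_insert_of_mem hb) c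
      (Finset.mem_insert_of_mem hc)) fun b hb => ?_) 1
    have hba : b ≠ a := by rintro rfl; exact ha hb
    have := hroot b (Finset.mem_insert_of_mem hb)
    rw [Polynomial.eval_mul, Polynomial.eval_sub, Polynomial.eval_X, Polynomial.eval_C] at this
    exact (hs b (Finset.mem_insert_of_mem hb) a (Finset.mem_insert_self a s) hba).mul_right_eq_zero.mp
      this

/-- Induction on n: where the leading coefficient in the first variable, of degree m, does not
vanish, at most m of the values in A_0 are roots. The degree condition keeps #A_0 - m positive. -/
theorem MvPolynomial.minProd_le_card_eval_ne_zero_of_degreeOf_lt [DecidableEq S] {n : ℕ}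
    (A : Fin n → Finset S)
    (hA : ∀ i, ∀ a ∈ A i, ∀ b ∈ A i, a ≠ b → IsUnit (a - b)) (f : MvPolynomial (Fin n) S)
    (hf : f ≠ 0) (hdeg : ∀ i, f.degreeOf i < (A i).card) :
    minProd (fun i => (A i).card) (∑ i, ((A i).card : ℤ) - f.totalDegree) ≤
      ((Fintype.piFinset A).filter fun x => eval x f ≠ 0).card := by
  induction n with
  | zero =>
    refine (minProd_le_prod (y := fun i => (A i).card) (fun i => i.elim0) (fun i => i.elim0)
      (by simp)).trans ?_
    rw [Finset.univ_eq_empty, Finset.prod_empty, Nat.one_le_iff_ne_zero, Finset.card_ne_zero]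
    refine ⟨Fin.elim0, Finset.mem_filter.mpr ⟨Fintype.mem_piFinset.mpr fun i => i.elim0,
      fun h => hf ?_⟩⟩
    rw [eq_C_of_isEmpty f, eval_C] at h
    rw [eq_C_of_isEmpty f]
    rw [h, C_0]
  | succ n ih =>
    set F := finSuccEquiv S n f with hF
    set m := F.natDegree with hm
    have hF0 : F ≠ 0 := by simpa [hF] using hf
    have hg0 : F.coeff m ≠ 0 := by simpa [hm] using hF0
    have hmdeg : m < (A 0).card := by
      rw [hm, hF, natDegree_finSuccEquiv]; exact hdeg 0
    have htot := totalDegree_coeff_finSuccEquiv_add_le f m hg0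
    have hIH := ih (fun i => A i.succ) (fun i => hA i.succ) (F.coeff m) hg0
      (fun i => (degreeOf_coeff_finSuccEquiv f i m).trans_lt (hdeg i.succ))
    obtain ⟨y, hy, hyN, hprod⟩ := exists_minProd_eq_prod (a := fun i => (A i.succ).card)
      (N := ∑ i, ((A (Fin.succ i)).card : ℤ) - (F.coeff m).totalDegree)
      (fun i => (Nat.zero_le _).trans_lt (hdeg i.succ)) (by simp)
    rw [hprod] at hIH
    set G := (Fintype.piFinset fun i => A (Fin.succ i)).filter fun x => eval x (F.coeff m) ≠ 0
    -- The minimiser y for the leading coefficient is extended by #A_0 - m; the sum is large enough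
    -- because m plus the degree of that coefficient is at most deg f.
    calc _ ≤ ∏ i, (Fin.cons ((A 0).card - m) y : Fin (n + 1) → ℕ) i := by
          apply minProd_le_prod
          · refine Fin.cases (by simp; omega) fun i => ?_
            simpa using (hy i).1
          · refine Fin.cases (by simp) fun i => ?_
            simpa using (hy i).2
          · simp only [Fin.sum_univ_succ, Fin.cons_zero, Fin.cons_succ]
            have : (((A 0).card - m : ℕ) : ℤ) = (A 0).card - m := by omega
            rw [this]
            have : ((F.coeff m).totalDegree : ℤ) + m ≤ f.totalDegree := by exact_mod_cast htot
            linarith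
      _ ≤ ((A 0).card - m) * G.card := by
          rw [Fin.prod_univ_succ]
          simpa using Nat.mul_le_mul_left _ hIH
      _ ≤ (G.sigma fun x =>
            (A 0).filter fun t => eval (Fin.cons t x : Fin (n + 1) → S) f ≠ 0).card := by
          rw [Finset.card_sigma, mul_comm, ← smul_eq_mul]
          refine Finset.card_nsmul_le_sum _ _ _ fun x hx => ?_
          have hx' := (Finset.mem_filter.mp hx).2
          have h1 : ((A 0).filter fun t => eval (Fin.cons t x : Fin (n + 1) → S) f = 0).card ≤ m := by
            have hne : Polynomial.map (eval x) F ≠ 0 := fun h => hx' (by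
              rw [← Polynomial.coeff_map, h, Polynomial.coeff_zero])
            refine (Polynomial.card_le_natDegree_of_isUnit_sub _ _ hne ?_ ?_).trans
              Polynomial.natDegree_map_le
            · exact fun a ha b hb => hA 0 a (Finset.mem_filter.mp ha).1 b (Finset.mem_filter.mp hb).1
            · intro a ha
              rw [← eval_eq_eval_mv_eval']
              exact (Finset.mem_filter.mp ha).2
          have h2 := Finset.card_filter_add_card_filter_not (s := A 0)
            (fun t => eval (Fin.cons t x : Fin (n + 1) → S) f = 0)
          simp only [ne_eq] at h2 ⊢
          omega
      _ ≤ _ := by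
          refine Finset.card_le_card_of_injOn
            (fun w => (Fin.cons w.2 w.1 : Fin (n + 1) → S)) ?_ ?_
          · rintro ⟨x, t⟩ h
            simp only [Finset.coe_sigma, Set.mem_sigma_iff, Finset.mem_coe, Finset.mem_filter, G,
              Fintype.mem_piFinset] at h ⊢
            exact ⟨Fin.cases (by simpa using h.2.1) (by simpa using h.1.1), h.2.2⟩
          · rintro ⟨x, t⟩ _ ⟨x', t'⟩ _ h
            obtain ⟨h1, h2⟩ := Fin.cons_injective2 h
            simp_all

/-- Each power X_i^e is replaced by its remainder modulo ∏_{a ∈ A_i} (X - a), which agrees with it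
on A_i and has degree at most e. -/
theorem MvPolynomial.exists_eval_eq_of_degreeOf_lt [Nontrivial S] {σ : Type*} [Fintype σ]
    [DecidableEq σ] (A : σ → Finset S) (hA : ∀ i, (A i).Nonempty) (f : MvPolynomial σ S) :
    ∃ g : MvPolynomial σ S, g.totalDegree ≤ f.totalDegree ∧ (∀ i, g.degreeOf i < (A i).card) ∧
      ∀ x ∈ Fintype.piFinset A, eval x g = eval x f := by
  let Q : σ → Polynomial S := fun i => ∏ a ∈ A i, (Polynomial.X - Polynomial.C a)
  have hQ : ∀ i, (Q i).Monic := fun i => Polynomial.monic_prod_X_sub_C _ _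
  have hQdeg : ∀ i, (Q i).natDegree = (A i).card := fun i => by
    simp [Q]
  let ρ : σ → ℕ → Polynomial S := fun i e => (Polynomial.X ^ e) %ₘ Q i
  have hρ1 : ∀ i e, (ρ i e).natDegree ≤ e := fun i e =>
    Polynomial.natDegree_modByMonic_le_left.trans (Polynomial.natDegree_X_pow_le e)
  have hρ2 : ∀ i e, (ρ i e).natDegree < (A i).card := fun i e => by
    rw [← hQdeg i]
    refine Polynomial.natDegree_modByMonic_lt _ (hQ i) fun h => ?_
    have := hQdeg i
    rw [h, Polynomial.natDegree_one] at this
    exact (Finset.card_pos.mpr (hA i)).ne this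
  have hρ3 : ∀ i e, ∀ a ∈ A i, (ρ i e).eval a = a ^ e := fun i e a ha => by
    have h := congrArg (Polynomial.eval a) (Polynomial.modByMonic_add_div (Polynomial.X ^ e) (Q i))
    have h0 : (Q i).eval a = 0 := by
      rw [Polynomial.eval_prod]
      exact Finset.prod_eq_zero ha (by simp)
    simpa [h0] using h
  have hdegOf : ∀ i j e, (Polynomial.aeval (X j : MvPolynomial σ S) (ρ j e)).degreeOf i ≤
      if i = j then (ρ j e).natDegree else 0 := fun i j e => by
    rw [Polynomial.aeval_eq_sum_range]
    refine (degreeOf_sum_le _ _ _).trans (Finset.sup_le fun k hk => ?_)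
    rw [smul_eq_C_mul]
    refine (degreeOf_C_mul_le _ _ _).trans ((degreeOf_pow_le _ _ _).trans ?_)
    rw [degreeOf_X]
    split_ifs
    · simpa [Nat.lt_succ_iff] using hk
    · simp
  refine ⟨∑ d ∈ f.support, C (f.coeff d) * ∏ i, Polynomial.aeval (X i) (ρ i (d i)), ?_, ?_, ?_⟩
  · refine totalDegree_finsetSum_le fun d hd => (totalDegree_mul _ _).trans ?_
    rw [totalDegree_C, zero_add]
    refine (totalDegree_finsetProd _ _).trans (le_trans ?_ (le_totalDegree hd))
    rw [Finsupp.sum_fintype _ _ fun _ => rfl]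
    refine Finset.sum_le_sum fun i _ => ?_
    rw [Polynomial.aeval_eq_sum_range]
    refine totalDegree_finsetSum_le fun k hk => (totalDegree_smul_le _ _).trans ?_
    rw [totalDegree_X_pow]
    have := hρ1 i (d i)
    simp at hk
    omega
  · intro i
    refine (degreeOf_sum_le _ _ _).trans_lt ((Finset.sup_lt_iff ?_).mpr fun d _ => ?_)
    · exact Finset.card_pos.mpr (hA i)
    · refine (degreeOf_C_mul_le _ _ _).trans_lt ((degreeOf_prod_le _ _ _).trans_lt ?_)
      refine (Finset.sum_le_sum fun j _ => hdegOf i j (d j)).trans_lt ?_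
      simpa using hρ2 i (d i)
  · intro x hx
    rw [Fintype.mem_piFinset] at hx
    conv_rhs => rw [f.as_sum]
    rw [map_sum, map_sum]
    refine Finset.sum_congr rfl fun d _ => ?_
    rw [map_mul, eval_C, map_prod, eval_monomial, Finsupp.prod_fintype _ _ fun _ => pow_zero _]
    congr 1
    refine Finset.prod_congr rfl fun i _ => ?_
    rw [← hρ3 i (d i) (x i) (hx i), Polynomial.aeval_def, Polynomial.hom_eval₂, eval_X,
      algebraMap_eq, show (eval x).comp C = RingHom.id S by ext; simp, Polynomial.eval₂_id]

/-- The Alon–Füredi theorem over a commutative ring, for a grid whose sides have differences of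
distinct elements invertible. -/
theorem MvPolynomial.minProd_le_card_eval_ne_zero [DecidableEq S] {n : ℕ} (A : Fin n → Finset S)
    (hA : ∀ i, ∀ a ∈ A i, ∀ b ∈ A i, a ≠ b → IsUnit (a - b)) (f : MvPolynomial (Fin n) S)
    (hf : ∃ x ∈ Fintype.piFinset A, eval x f ≠ 0) :
    minProd (fun i => (A i).card) (∑ i, ((A i).card : ℤ) - f.totalDegree) ≤
      ((Fintype.piFinset A).filter fun x => eval x f ≠ 0).card := by
  obtain ⟨x, hx, hfx⟩ := hf
  have : Nontrivial S := ⟨_, _, hfx⟩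
  have hne : ∀ i, (A i).Nonempty := fun i => ⟨x i, Fintype.mem_piFinset.mp hx i⟩
  obtain ⟨g, hg1, hg2, hg3⟩ := exists_eval_eq_of_degreeOf_lt A hne f
  have hg0 : g ≠ 0 := by
    rintro rfl
    exact hfx (by rw [← hg3 x hx, map_zero])
  have h := minProd_le_card_eval_ne_zero_of_degreeOf_lt A hA g hg0 hg2
  rw [Finset.filter_congr fun x hx => by rw [hg3 x hx]] at h
  refine le_trans ?_ h
  obtain ⟨y, hy, hyN, hprod⟩ := exists_minProd_eq_prod (a := fun i => (A i).card)
    (N := ∑ i, ((A i).card : ℤ) - g.totalDegree) (fun i => Finset.card_pos.mpr (hne i)) (by simp)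
  rw [hprod]
  exact minProd_le_prod (fun i => (hy i).1) (fun i => (hy i).2) (by omega)

end AlonFuredi

/-! ### Powers of an ideal and truncated orders -/

theorem PairwiseIncongruent.injOn_mk {R : Type*} [CommRing R] {A : Set R} {I J : Ideal R}
    (hA : PairwiseIncongruent A I)
    (hJI : J ≤ I) : Set.InjOn (Ideal.Quotient.mk J) A := fun x hx y hy h => by
  by_contra hxy
  exact hA x hx y hy hxy (hJI (Ideal.Quotient.eq.mp h))

theorem Ideal.prod_mem_pow_sum_succ {R ι : Type*} [CommRing R] {p : Ideal R} (s : Finset ι)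
    (x : ι → R) (k : ι → ℕ) (hx : ∀ i ∈ s, x i ∈ p ^ k i) {i : ι} (hi : i ∈ s) (hxi : x i ∈ p ^ (k i + 1)) :
    ∏ i ∈ s, x i ∈ p ^ (∑ i ∈ s, k i + 1) := by
  classical
  rw [← Finset.mul_prod_erase s x hi, ← Finset.add_sum_erase s k hi, add_right_comm, pow_add]
  refine mul_mem_mul hxi ?_
  rw [← Finset.prod_pow_eq_pow_sum]
  exact prod_mem_prod fun j hj => hx j (Finset.mem_of_mem_erase hj)

section TruncatedOrder

variable {R : Type*} [CommRing R]

/-- The largest `k ≤ v` with `x ∈ p ^ k`. -/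
noncomputable def Ideal.truncOrder (p : Ideal R) (v : ℕ) (x : R) : ℕ :=
  open scoped Classical in Nat.findGreatest (fun k => x ∈ p ^ k) v

namespace Ideal

variable {p : Ideal R} {v : ℕ} {x y : R}

theorem mem_pow_truncOrder : x ∈ p ^ p.truncOrder v x := by
  classical
  exact Nat.findGreatest_spec (P := fun k => x ∈ p ^ k) (Nat.zero_le v) (by simp)

theorem truncOrder_le : p.truncOrder v x ≤ v := by
  classical
  exact Nat.findGreatest_le v

theorem le_truncOrder {k : ℕ} (hk : k ≤ v) (hx : x ∈ p ^ k) : k ≤ p.truncOrder v x := by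
  classical
  exact Nat.le_findGreatest hk hx

theorem truncOrder_eq_of_mem (hx : x ∈ p ^ v) : p.truncOrder v x = v :=
  truncOrder_le.antisymm (le_truncOrder le_rfl hx)

theorem truncOrder_lt_of_notMem (hx : x ∉ p ^ v) : p.truncOrder v x < v := by
  refine truncOrder_le.lt_of_ne fun h => hx ?_
  have := mem_pow_truncOrder (p := p) (v := v) (x := x)
  rwa [h] at this

theorem notMem_pow_truncOrder_succ (hx : x ∉ p ^ v) : x ∉ p ^ (p.truncOrder v x + 1) := fun h =>
  (le_truncOrder (truncOrder_lt_of_notMem hx) h).not_gt (Nat.lt_succ_self _)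

theorem truncOrder_eq_zero (hx : x ∉ p) : p.truncOrder v x = 0 := by
  by_contra h
  exact hx (pow_le_self h mem_pow_truncOrder)

theorem truncOrder_le_of_sub_mem (h : x - y ∈ p ^ v) : p.truncOrder v x ≤ p.truncOrder v y :=
  le_truncOrder truncOrder_le <| by
    rw [← sub_sub_cancel x y]
    exact sub_mem mem_pow_truncOrder (pow_le_pow_right truncOrder_le h)

/-- Truncation at v makes the order a function on R/𝔭^v, finite even at 0, so it can be summed over
classes. -/
theorem truncOrder_eq_of_sub_mem (h : x - y ∈ p ^ v) : p.truncOrder v x = p.truncOrder v y :=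
  (truncOrder_le_of_sub_mem h).antisymm
    (truncOrder_le_of_sub_mem (by rw [← neg_sub]; exact neg_mem h))

end Ideal

end TruncatedOrder

/-! ### Exact powers of a prime and the detecting polynomial -/

section ExactPower

variable {R : Type*} [CommRing R] [IsDedekindDomain R] {p : Ideal R}

/-- Multiplicities of a nonzero prime ideal add. For `p = ⊥` the only exact exponent is 0, and the
claim is that nonzero elements have nonzero product. -/
theorem Ideal.mul_notMem_pow_add_succ [hp : p.IsPrime] {i j : ℕ} {a b : R} (ha : a ∈ p ^ i)
    (ha' : a ∉ p ^ (i + 1)) (hb : b ∈ p ^ j) (hb' : b ∉ p ^ (j + 1)) :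
    a * b ∉ p ^ (i + j + 1) := by
  by_cases h0 : p = ⊥
  · subst h0
    have hne : ∀ {k : ℕ} {c : R}, c ∈ (⊥ : Ideal R) ^ k → c ∉ (⊥ : Ideal R) ^ (k + 1) →
        k = 0 ∧ c ≠ 0 := fun {k c} h h' => by
      refine ⟨?_, fun hc => h' (by simp [hc])⟩
      by_contra hk
      have hc : c ∈ (⊥ : Ideal R) := pow_le_self hk h
      exact h' (by simp [(Submodule.mem_bot R).mp hc])
    obtain ⟨rfl, ha0⟩ := hne ha ha'
    obtain ⟨rfl, hb0⟩ := hne hb hb'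
    simpa using ⟨ha0, hb0⟩
  · have hprime := prime_of_isPrime h0 hp
    rw [← span_singleton_le_iff_mem, ← dvd_iff_le] at ha ha' hb hb' ⊢
    have hab := emultiplicity_mul hprime (a := span {a}) (b := span {b})
    rw [emultiplicity_eq_coe.mpr ⟨ha, ha'⟩, emultiplicity_eq_coe.mpr ⟨hb, hb'⟩,
      span_singleton_mul_span_singleton] at hab
    exact (emultiplicity_eq_coe (n := i + j).mp (by rw [hab]; push_cast; rfl)).2

theorem Ideal.prod_notMem_pow_sum_succ [hp : p.IsPrime] {ι : Type*} (s : Finset ι) (x : ι → R)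
    (k : ι → ℕ) (hx : ∀ i ∈ s, x i ∈ p ^ k i ∧ x i ∉ p ^ (k i + 1)) :
    ∏ i ∈ s, x i ∉ p ^ (∑ i ∈ s, k i + 1) := by
  classical
  induction s using Finset.induction_on with
  | empty => simpa [← Ideal.ne_top_iff_one] using hp.ne_top
  | insert i s hi ih =>
    rw [Finset.prod_insert hi, Finset.sum_insert hi]
    have hs : ∀ j ∈ s, x j ∈ p ^ k j ∧ x j ∉ p ^ (k j + 1) :=
      fun j hj => hx j (Finset.mem_insert_of_mem hj)
    have h := hx i (Finset.mem_insert_self i s)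
    refine mul_notMem_pow_add_succ h.1 h.2 ?_ (ih hs)
    rw [← Finset.prod_pow_eq_pow_sum]
    exact prod_mem_prod fun j hj => (hs j hj).1

/-- Equality can fail only for `p = ⊥`, where `p ^ v = p`. -/
theorem Ideal.finite_quotient_pow_and_card_le (hp : p.IsMaximal) [Finite (R ⧸ p)] {v : ℕ}
    (hv : 1 ≤ v) : Finite (R ⧸ p ^ v) ∧ Nat.card (R ⧸ p ^ v) ≤ Nat.card (R ⧸ p) ^ v := by
  have hpos : 0 < Nat.card (R ⧸ p) := Nat.card_pos
  by_cases h0 : p = ⊥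
  · have hpv : p ^ v = p := by
      rw [h0]
      exact bot_pow (by omega)
    rw [hpv]
    exact ⟨inferInstance, Nat.le_self_pow (by omega) _⟩
  · have hcard : Nat.card (R ⧸ p ^ v) = Nat.card (R ⧸ p) ^ v := by
      have := hp.isPrime
      simpa only [Submodule.cardQuot_apply] using cardQuot_pow_of_prime (P := p) h0 (i := v)
    exact ⟨Nat.finite_of_card_ne_zero (by rw [hcard]; positivity), hcard.le⟩

/-- A polynomial whose values on `R` detect membership in `B` modulo `p ^ v` by being
exactly divisible by a fixed power of `p`. -/
theorem exists_polynomial_notMem_pow_iff_memMod (hp : p.IsMaximal) [Finite (R ⧸ p)] {v : ℕ}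
    (hv : 1 ≤ v) {B : Set R} (hB : PairwiseIncongruent B p) :
    ∃ (g : Polynomial R) (c : ℕ),
      (g.natDegree : ℤ) ≤ (Nat.card (R ⧸ p) : ℤ) ^ v - B.ncard ∧
      (∀ x, g.eval x ∈ p ^ c) ∧ ∀ x, g.eval x ∉ p ^ (c + 1) ↔ MemMod B (p ^ v) x := by
  classical
  have := hp.isPrime
  obtain ⟨hfin, hcard⟩ := Ideal.finite_quotient_pow_and_card_le hp hv
  have := Fintype.ofFinite (R ⧸ p ^ v)
  have hle : p ^ v ≤ p := Ideal.pow_le_self (by omega)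
  let mk := Ideal.Quotient.mk (p ^ v)
  let out : R ⧸ p ^ v → R := Quotient.out
  have hout : ∀ c, mk (out c) = c := fun c => Quotient.out_eq c
  let w : R ⧸ p ^ v → ℕ := fun c => p.truncOrder v (out c)
  have hw : ∀ x, p.truncOrder v x = w (mk x) := fun x =>
    Ideal.truncOrder_eq_of_sub_mem (Ideal.Quotient.eq.mp (hout (mk x)).symm)
  have hw0 : w 0 = v := by
    rw [← map_zero mk, ← hw]
    exact Ideal.truncOrder_eq_of_mem (zero_mem _)
  let B' : Finset (R ⧸ p ^ v) := Finset.univ.filter (· ∈ mk '' B)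
  have hB'mem : ∀ c, c ∈ B' ↔ ∃ b ∈ B, mk b = c := fun c => by simp [B']
  have hB'card : B'.card = B.ncard := by
    rw [← (hB.injOn_mk hle).ncard_image, ← Set.ncard_coe_finset]
    congr 1
    ext c
    simp [B', mk]
  have hmem : ∀ x, MemMod B (p ^ v) x ↔ mk x ∈ B' := fun x => by
    rw [hB'mem]
    refine exists_congr fun b => and_congr_right fun _ => ?_
    rw [eq_comm, Ideal.Quotient.eq]
  -- Elements of B are incongruent modulo 𝔭, so at most one of their classes is congruent to x
  -- modulo 𝔭 and contributes.
  have hunique : ∀ x, ∀ b ∈ B', ∀ c ∈ B', w (mk x - b) ≠ 0 → c ≠ b → w (mk x - c) = 0 := by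
    intro x b hb c hc h hcb
    obtain ⟨b, hb', rfl⟩ := (hB'mem b).mp hb
    obtain ⟨c, hcB, rfl⟩ := (hB'mem c).mp hc
    rw [← map_sub, ← hw] at h ⊢
    have hxb : x - b ∈ p := not_not.mp (mt Ideal.truncOrder_eq_zero h)
    refine Ideal.truncOrder_eq_zero fun hxc => ?_
    refine hB c hcB b hb' (fun h => hcb (by rw [h])) ?_
    rw [← sub_sub_sub_cancel_left _ _ x]
    exact sub_mem hxb hxc
  -- As c runs over all classes so does x - c: the total is independent of x, and the class 0
  -- accounts for v of it.
  have htotal : ∀ x, ∑ c ∈ B'ᶜ, w (mk x - c) + ∑ c ∈ B', w (mk x - c) =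
      ∑ c ∈ Finset.univ.erase 0, w c + v := fun x => by
    rw [Finset.sum_compl_add_sum,
      show ∑ c, w (mk x - c) = ∑ c, w c from (Equiv.subLeft (mk x)).sum_comp w,
      ← Finset.sum_erase_add _ _ (Finset.mem_univ (0 : R ⧸ p ^ v)), hw0]
  let g : Polynomial R := ∏ c ∈ B'ᶜ, (Polynomial.X - Polynomial.C (out c))
  have hg : ∀ x, g.eval x = ∏ c ∈ B'ᶜ, (x - out c) := fun x => by
    simp [g, Polynomial.eval_prod]
  have hword : ∀ x c, p.truncOrder v (x - out c) = w (mk x - c) := fun x c => by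
    rw [hw, map_sub, hout]
  have hgmem : ∀ x, g.eval x ∈ p ^ ∑ c ∈ B'ᶜ, w (mk x - c) := fun x => by
    rw [hg, ← Finset.prod_pow_eq_pow_sum]
    refine Ideal.prod_mem_prod fun c _ => ?_
    rw [← hword]
    exact Ideal.mem_pow_truncOrder
  -- When x lies in B modulo 𝔭^v, the classes of B use up exactly v of the total.
  have hin : ∀ x, mk x ∈ B' → ∑ c ∈ B'ᶜ, w (mk x - c) = ∑ c ∈ Finset.univ.erase 0, w c := by
    intro x hx
    have h := htotal x
    rw [Finset.sum_eq_single_of_mem (s := B') _ hx fun c hc hcx => hunique x _ hx c hc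
      (by rw [sub_self, hw0]; omega) hcx, sub_self, hw0] at h
    omega
  -- Otherwise they use less than v, leaving at least one more for the factors of g.
  have hnotin : ∀ x, mk x ∉ B' → ∑ c ∈ Finset.univ.erase 0, w c + 1 ≤ ∑ c ∈ B'ᶜ, w (mk x - c) := by
    intro x hx
    have h := htotal x
    suffices hlt : ∑ c ∈ B', w (mk x - c) < v by omega
    by_cases hall : ∀ c ∈ B', w (mk x - c) = 0
    · rw [Finset.sum_eq_zero hall]
      omega
    · push Not at hall
      obtain ⟨b, hb, hb0⟩ := hall
      rw [Finset.sum_eq_single_of_mem b hb fun c hc hcb => hunique x b hb c hc hb0 hcb, ← hword]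
      refine Ideal.truncOrder_lt_of_notMem fun h => hx ?_
      rw [← hout b] at hb
      rwa [show mk x = mk (out b) from Ideal.Quotient.eq.mpr h]
  refine ⟨g, ∑ c ∈ Finset.univ.erase 0, w c, ?_, fun x => ?_, fun x => ?_⟩
  · rw [Polynomial.natDegree_finsetProd_X_sub_C_eq_card, Finset.card_compl, hB'card,
      ← Nat.card_eq_fintype_card, Nat.cast_sub]
    · have : (Nat.card (R ⧸ p ^ v) : ℤ) ≤ (Nat.card (R ⧸ p) : ℤ) ^ v := by exact_mod_cast hcard
      linarith
    · rw [← hB'card, Nat.card_eq_fintype_card]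
      exact Finset.card_le_univ _
  · by_cases hx : mk x ∈ B'
    · rw [← hin x hx]
      exact hgmem x
    · exact Ideal.pow_le_pow_right ((Nat.le_succ _).trans (hnotin x hx)) (hgmem x)
  · rw [hmem]
    constructor
    · intro h
      by_contra hx
      exact h (Ideal.pow_le_pow_right (hnotin x hx) (hgmem x))
    · intro hx
      rw [← hin x hx, hg]
      refine Ideal.prod_notMem_pow_sum_succ _ _ _ fun c hc => ?_
      rw [← hword]
      -- The class c is not that of x, so the order of x - c is below v and truncation does not
      -- alter it.
      refine ⟨Ideal.mem_pow_truncOrder, Ideal.notMem_pow_truncOrder_succ fun h => ?_⟩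
      rw [Finset.mem_compl, ← hout c] at hc
      exact hc (by rwa [← show mk x = mk (out c) from Ideal.Quotient.eq.mpr h])

end ExactPower

/-! ### Composition of polynomials and the main theorem -/

theorem MvPolynomial.totalDegree_aeval_le {R σ : Type*} [CommRing R] (g : Polynomial R)
    (f : MvPolynomial σ R) : (Polynomial.aeval f g).totalDegree ≤ g.natDegree * f.totalDegree := by
  rw [Polynomial.aeval_eq_sum_range]
  refine totalDegree_finsetSum_le fun k hk =>
    (totalDegree_smul_le _ _).trans ((totalDegree_pow _ _).trans ?_)
  exact Nat.mul_le_mul_right _ (Nat.lt_succ_iff.mp (Finset.mem_range.mp hk))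

theorem MvPolynomial.totalDegree_map_le {R S σ : Type*} [CommRing R] [CommRing S] (φ : R →+* S)
    (f : MvPolynomial σ R) : (map φ f).totalDegree ≤ f.totalDegree :=
  Finset.sup_mono (support_map_subset φ f)

theorem MvPolynomial.eval_aeval_eq {R σ : Type*} [CommRing R] (g : Polynomial R)
    (f : MvPolynomial σ R) (x : σ → R) :
    eval x (Polynomial.aeval f g) = g.eval (eval x f) := by
  rw [Polynomial.aeval_def, Polynomial.hom_eval₂, algebraMap_eq,
    show (eval x).comp C = RingHom.id R by ext; simp, Polynomial.eval₂_id]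

theorem theorem1p6 {R : Type*} [CommRing R] [IsDedekindDomain R]
    (p : Ideal R) (hp : p.IsMaximal) [Finite (R ⧸ p)] (q : ℕ) (hq : Nat.card (R ⧸ p) = q)
    (n r : ℕ) (hn : 1 ≤ n) (hr : 1 ≤ r) (v : Fin r → ℕ) (hv : ∀ j, 1 ≤ v j)
    (A : Fin n → Set R) (B : Fin r → Set R)
    (hA : ∀ i, (A i).Nonempty) (hB : ∀ j, (B j).Nonempty)
    (hAp : ∀ i, PairwiseIncongruent (A i) p) (hBp : ∀ j, PairwiseIncongruent (B j) p)
    (f : Fin r → MvPolynomial (Fin n) R) :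
    solutionSet p v A B f = ∅ ∨
      minProd (fun i => (A i).ncard)
          ((∑ i, ((A i).ncard : ℤ))
            - ∑ j, ((q : ℤ) ^ v j - ((B j).ncard : ℤ)) * ((f j).totalDegree : ℤ))
        ≤ (solutionSet p v A B f).ncard := by
  classical
  have := hp.isPrime
  subst hq
  rw [or_iff_not_imp_left, ← ne_eq, ← Set.nonempty_iff_ne_empty]
  rintro ⟨x₀, hx₀A, hx₀B⟩
  have hAfin : ∀ i, (A i).Finite := fun i =>
    Set.Finite.of_finite_image (Set.toFinite _) ((hAp i).injOn_mk le_rfl)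
  have hsolfin : (solutionSet p v A B f).Finite :=
    (Set.Finite.pi' hAfin).subset fun x hx => hx.1
  choose g c hgdeg hgmem hgiff using
    fun j => exists_polynomial_notMem_pow_iff_memMod hp (hv j) (hBp j)
  let P : MvPolynomial (Fin n) R := ∏ j, Polynomial.aeval (f j) (g j)
  let N := ∑ j, c j + 1
  have hP : ∀ x, MvPolynomial.eval x P ∉ p ^ N ↔
      ∀ j, MemMod (B j) (p ^ v j) (MvPolynomial.eval x (f j)) := fun x => by
    simp only [P, map_prod, MvPolynomial.eval_aeval_eq]
    constructor
    · intro h j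
      by_contra hj
      rw [← hgiff, not_not] at hj
      exact h (Ideal.prod_mem_pow_sum_succ _ _ _ (fun i _ => hgmem i _) (Finset.mem_univ j) hj)
    · exact fun h => Ideal.prod_notMem_pow_sum_succ _ _ _
        fun j _ => ⟨hgmem j _, (hgiff j _).mpr (h j)⟩
  let mk := Ideal.Quotient.mk (p ^ N)
  have heval : ∀ x, MvPolynomial.eval (mk ∘ x) (MvPolynomial.map mk P) =
      mk (MvPolynomial.eval x P) := fun x => by
    rw [MvPolynomial.eval_map, ← MvPolynomial.eval₂_id, MvPolynomial.eval₂_comp_left,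
      RingHom.comp_id]
  let A' : Fin n → Finset (R ⧸ p ^ N) := fun i => (hAfin i).toFinset.image mk
  have hA'card : ∀ i, (A' i).card = (A i).ncard := fun i => by
    rw [Finset.card_image_of_injOn, Set.ncard_eq_toFinset_card _ (hAfin i)]
    rw [Set.Finite.coe_toFinset]
    exact (hAp i).injOn_mk (Ideal.pow_le_self (Nat.succ_ne_zero _))
  -- An element outside the maximal ideal 𝔭 is a unit modulo every power of 𝔭.
  have hA'unit : ∀ i, ∀ a ∈ A' i, ∀ b ∈ A' i, a ≠ b → IsUnit (a - b) := by
    intro i a ha b hb hab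
    simp only [A', Finset.mem_image, Set.Finite.mem_toFinset] at ha hb
    obtain ⟨a, ha, rfl⟩ := ha
    obtain ⟨b, hb, rfl⟩ := hb
    rw [← map_sub]
    exact Ideal.Quotient.isUnit_mk_pow_of_notMem _
      (hAp i a ha b hb fun h => hab (by rw [h]))
  have hAF := MvPolynomial.minProd_le_card_eval_ne_zero A' hA'unit (MvPolynomial.map mk P)
    ⟨mk ∘ x₀, Fintype.mem_piFinset.mpr fun i =>
      Finset.mem_image_of_mem _ ((hAfin i).mem_toFinset.mpr (hx₀A i)), by
        rw [heval, ne_eq, Ideal.Quotient.eq_zero_iff_mem]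
        exact (hP x₀).mpr hx₀B⟩
  simp only [hA'card] at hAF
  have hdeg : ((MvPolynomial.map mk P).totalDegree : ℤ) ≤
      ∑ j, ((Nat.card (R ⧸ p) : ℤ) ^ v j - (B j).ncard) * (f j).totalDegree := by
    have h1 : (MvPolynomial.map mk P).totalDegree ≤ ∑ j, (g j).natDegree * (f j).totalDegree :=
      (MvPolynomial.totalDegree_map_le mk P).trans <|
        (MvPolynomial.totalDegree_finsetProd _ _).trans
        (Finset.sum_le_sum fun j _ => MvPolynomial.totalDegree_aeval_le _ _)
    calc ((MvPolynomial.map mk P).totalDegree : ℤ)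
        ≤ ∑ j, ((g j).natDegree : ℤ) * (f j).totalDegree := by exact_mod_cast h1
      _ ≤ _ := Finset.sum_le_sum fun j _ =>
          mul_le_mul_of_nonneg_right (hgdeg j) (Int.natCast_nonneg _)
  obtain ⟨y, hy, hyN, hprod⟩ := exists_minProd_eq_prod (a := fun i => (A i).ncard)
    (N := ∑ i, ((A i).ncard : ℤ) - (MvPolynomial.map mk P).totalDegree)
    (fun i => (Set.ncard_pos (hAfin i)).mpr (hA i)) (by simp)
  calc _ ≤ ∏ i, y i := minProd_le_prod (fun i => (hy i).1) (fun i => (hy i).2) (by linarith)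
    _ ≤ _ := hprod.symm.le.trans hAF
    -- Each nonvanishing point of the residue grid lifts to a point of Z.
    _ ≤ ((fun x : Fin n → R => mk ∘ x) '' solutionSet p v A B f).ncard := by
        rw [← Set.ncard_coe_finset]
        refine Set.ncard_le_ncard (fun z hz => ?_) (hsolfin.image _)
        obtain ⟨hzA, hz0⟩ := Finset.mem_filter.mp hz
        have hzA' : ∀ i, ∃ a ∈ A i, mk a = z i := fun i => by
          simpa [A'] using Fintype.mem_piFinset.mp hzA i
        choose x hxA hxz using hzA'
        obtain rfl : mk ∘ x = z := funext hxz
        refine ⟨x, ⟨hxA, (hP x).mp ?_⟩, rfl⟩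
        rwa [heval, ne_eq, Ideal.Quotient.eq_zero_iff_mem] at hz0
    _ ≤ _ := Set.ncard_image_le hsolfin
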